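/- Let $m\ge 1$, $d=2^m$, and let $\mathbb C^d$ have canonical orthonormal basis $|j\rangle$, $j\in\mathbb F_2^m$. For $a=(a_z|a_x)^t\in\mathbb F_2^{2m}$ let $$XZ(a)=\bigotimes_{k=1}^m i^{\,a_x^{(k)}a_z^{(k)}}X^{a_x^{(k)}}Z^{a_z^{(k)}},\qquad X|j\rangle=|j+1\rangle,\quad Z|j\rangle=(-1)^j|j\rangle ,$$ (exponents taken in $\{0,1\}\subset\mathbb Z$) and for a matrix $G$ of size $2m\times m$ over $\mathbb F_2$ let $\langle G\rangle=\{XZ(Gc): c\in\mathbb F_2^m\setminus\{0\}\}$. An orthonormal basis is identified with the unitary matrix having the basis vectors as columns; it is an eigenbasis of $\langle G\rangle$ if it consists of common eigenvectors of all operators in $\langle G\rangle$. Orthonormal bases $(u_i)$, $(v_j)$ are mutually unbiased if $|\langle u_i,v_j\rangle|^2=1/d$ for all $i,j$; a complete set of MUBs consists of $d+1$ pairwise mutually unbiased bases. Two such sets $\{\mathcal B_k\}$ and $\{\mathcal B'_k\}$ are equivalent if there are a unitary $U$, a permutation $\pi$ of the indices and monomial matrices $W_k=D_k\Pi_k$ ($D_k$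 diagonal with entries of modulus one, $\Pi_k$ a permutation matrix) such that $\mathcal B'_k=U\mathcal B_{\pi(k)}W_k$ for all $k$. **Lemma.** Let $B,B'\in M_m(\mathbb F_2)$ be symmetric matrices with the same irreducible characteristic polynomial $p$. 1. The classes generated by $(\mathbf 1_m,0_m)^t$ and by $(q(B),\mathbf 1_m)^t$, where $q$ runs over all $2^m$ polynomials over $\mathbb F_2$ of degree less than $m$, are $d+1$ distinct classes. They possess eigenbases, and every choice of one eigenbasis for each class is a complete set of MUBs. The same holds for $B'$, and any complete set of MUBs obtained in this way from $B$ is equivalent to any one obtained from $B'$. 2. Suppose moreover that the Fibonacci index of $p$ is $d+1$, that is, $d+1$ is the least $n\ge1$ such that $p$ divides $F_n$, where $F_0=0$, $F_1=1$, $F_{n+1}=xF_n+F_{n-1}$ over $\mathbb F_2$. Then the same statements (distinctness, existence of eigenbases, complete sets of MUBs, equivalence) hold for the cyclic classes generated by $C^k(\mathbf 1_m,0_m)^t$, $k=0,\dots,d$, with $C=\begin{pmatrix}B&\mathbf 1_m\\ \mathbf 1_m&0_m\end{pmatrix}$, and for those formed in the same way from $B'$. -/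

import Mathlib

namespace CyclicMUB

open Matrix Polynomial

noncomputable section

/-! ### Bases, mutual unbiasedness, equivalence

An orthonormal basis of the Hilbert space with canonical orthonormal basis indexed by `n` is
identified with the unitary matrix whose columns are the basis vectors. -/

/-- Two orthonormal bases are mutually unbiased if all squared overlaps equal `1 / d`, where `d` is
the dimension. -/
def MutuallyUnbiased {n : Type*} [Fintype n] [DecidableEq n]
    (U V : Matrix.unitaryGroup n ℂ) : Prop :=
  ∀ i j : n, ‖∑ x : n, star ((U : Matrix n n ℂ) x i) * (V : Matrix n n ℂ) x j‖ ^ 2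
    = 1 / (Fintype.card n : ℝ)

/-- A family of orthonormal bases is mutually unbiased if any two members with distinct indices
are. -/
def IsMUB {n ι : Type*} [Fintype n] [DecidableEq n] (S : ι → Matrix.unitaryGroup n ℂ) : Prop :=
  ∀ k l : ι, k ≠ l → MutuallyUnbiased (S k) (S l)

/-- A monomial matrix `W = D * Π`: `D` diagonal with entries of modulus one, `Π` a permutation
matrix. -/
def IsMonomial {n : Type*} [Fintype n] [DecidableEq n] (W : Matrix n n ℂ) : Prop :=
  ∃ (c : n → ℂ) (σ : Equiv.Perm n), (∀ i, ‖c i‖ = 1) ∧ W = Matrix.diagonal c * σ.permMatrix ℂ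

/-- Equivalence of families of bases: `S' k = U * S (π k) * W k` for one unitary `U`, one
permutation `π` of the bases, and monomial matrices `W k`. -/
def EquivalentBases {n ι : Type*} [Fintype n] [DecidableEq n]
    (S S' : ι → Matrix.unitaryGroup n ℂ) : Prop :=
  ∃ (U : Matrix.unitaryGroup n ℂ) (π : Equiv.Perm ι) (W : ι → Matrix n n ℂ),
    (∀ k, IsMonomial (W k)) ∧
      ∀ k, (S' k : Matrix n n ℂ) = (U : Matrix n n ℂ) * (S (π k) : Matrix n n ℂ) * W k

/-! ### Pauli operators on `m` qubits -/

/-- The index set of the canonical basis `|j⟩`, `j ∈ 𝔽₂ᵐ`, of the `2 ^ m`-dimensional space. -/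
abbrev Qubits (m : ℕ) : Type := Fin m → ZMod 2

/-- `X |j⟩ = |j + 1⟩`. -/
def pauliX : Matrix (ZMod 2) (ZMod 2) ℂ := Matrix.of fun i j => if i = j + 1 then 1 else 0

/-- `Z |j⟩ = (-1) ^ j |j⟩`. -/
def pauliZ : Matrix (ZMod 2) (ZMod 2) ℂ := Matrix.diagonal fun j => (-1) ^ j.val

/-- The Pauli operator of `a = (a_z | a_x)`, with `a_z = a ∘ Sum.inl` and `a_x = a ∘ Sum.inr`:
the tensor product over `k` of the matrices `i ^ (a_x k * a_z k) • X ^ (a_x k) * Z ^ (a_z k)`,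
where the exponents are the representatives in `{0, 1}`. -/
def pauli {m : ℕ} (a : Fin m ⊕ Fin m → ZMod 2) : Matrix (Qubits m) (Qubits m) ℂ :=
  Matrix.of fun i j => ∏ k : Fin m,
    (Complex.I ^ ((a (Sum.inr k)).val * (a (Sum.inl k)).val) •
      (pauliX ^ (a (Sum.inr k)).val * pauliZ ^ (a (Sum.inl k)).val)) (i k) (j k)

/-- The class of Pauli operators generated by a `2m × m` matrix `G` over `𝔽₂`: the operators of the
vectors `G c` with `c ≠ 0`. -/
def pauliClass {m : ℕ} (G : Matrix (Fin m ⊕ Fin m) (Fin m) (ZMod 2)) :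
    Set (Matrix (Qubits m) (Qubits m) ℂ) :=
  {A | ∃ c : Fin m → ZMod 2, c ≠ 0 ∧ A = pauli (G *ᵥ c)}

/-- The basis `U` consists of common eigenvectors of all operators in the class `𝒞`. -/
def IsEigenbasis {n : Type*} [Fintype n] [DecidableEq n]
    (𝒞 : Set (Matrix n n ℂ)) (U : Matrix.unitaryGroup n ℂ) : Prop :=
  ∀ A ∈ 𝒞, ∀ j : n, ∃ μ : ℂ, A *ᵥ (fun i => (U : Matrix n n ℂ) i j)
    = μ • fun i => (U : Matrix n n ℂ) i j

/-- The `2 ^ m + 1` bases `S k` are eigenbases of the classes in `𝔠`, one for each class (so `𝔠`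
has exactly `2 ^ m + 1` members); the enumeration is arbitrary. -/
def AreEigenbases {m : ℕ} (𝔠 : Set (Set (Matrix (Qubits m) (Qubits m) ℂ)))
    (S : Fin (2 ^ m + 1) → Matrix.unitaryGroup (Qubits m) ℂ) : Prop :=
  ∃ 𝒞 : Fin (2 ^ m + 1) → Set (Matrix (Qubits m) (Qubits m) ℂ),
    Function.Injective 𝒞 ∧ Set.range 𝒞 = 𝔠 ∧ ∀ k, IsEigenbasis (𝒞 k) (S k)

/-- The classes in `𝔠` have eigenbases, and every choice of eigenbases is a complete set of
(`2 ^ m + 1`) mutually unbiased bases. -/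
def GeneratesCompleteMUB {m : ℕ} (𝔠 : Set (Set (Matrix (Qubits m) (Qubits m) ℂ))) : Prop :=
  (∃ S, AreEigenbases 𝔠 S) ∧ ∀ S, AreEigenbases 𝔠 S → IsMUB S

/-- Any choices of eigenbases of `𝔠` and of `𝔠'` are equivalent. -/
def EquivalentEigenbases {m : ℕ} (𝔠 𝔠' : Set (Set (Matrix (Qubits m) (Qubits m) ℂ))) : Prop :=
  ∀ S S', AreEigenbases 𝔠 S → AreEigenbases 𝔠' S' → EquivalentBases S S'

/-! ### The classes generated by a matrix `B` over `𝔽₂` -/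

/-- The generator `(1, 0)ᵗ` of the `Z`-type Pauli operators. -/
def zGenerator (m : ℕ) : Matrix (Fin m ⊕ Fin m) (Fin m) (ZMod 2) :=
  Matrix.fromRows 1 0

/-- The classes in standard form: the one of `(1, 0)ᵗ`, and those of `(q(B), 1)ᵗ` for all
polynomials `q` of degree less than `m`. -/
def standardClasses {m : ℕ} (B : Matrix (Fin m) (Fin m) (ZMod 2)) :
    Set (Set (Matrix (Qubits m) (Qubits m) ℂ)) :=
  {𝒞 | 𝒞 = pauliClass (zGenerator m) ∨
    ∃ q : (ZMod 2)[X], q.degree < m ∧ 𝒞 = pauliClass (Matrix.fromRows (aeval B q) 1)}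

/-- The stabilizer matrix with blocks `B, 1, 1, 0`. -/
def stabilizer {m : ℕ} (B : Matrix (Fin m) (Fin m) (ZMod 2)) :
    Matrix (Fin m ⊕ Fin m) (Fin m ⊕ Fin m) (ZMod 2) :=
  Matrix.fromBlocks B 1 1 0

/-- The cyclic classes: those of `C ^ k * (1, 0)ᵗ`, `k = 0, …, 2 ^ m`, with `C` the stabilizer
matrix. -/
def cyclicClasses {m : ℕ} (B : Matrix (Fin m) (Fin m) (ZMod 2)) :
    Set (Set (Matrix (Qubits m) (Qubits m) ℂ)) :=
  {𝒞 | ∃ k : ℕ, k ≤ 2 ^ m ∧ 𝒞 = pauliClass (stabilizer B ^ k * zGenerator m)}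

/-- Fibonacci polynomials over `𝔽₂`. -/
def fibPoly : ℕ → (ZMod 2)[X]
  | 0 => 0
  | 1 => 1
  | n + 2 => X * fibPoly (n + 1) + fibPoly n

/-- `N` is the Fibonacci index of `p`: the least positive `n` such that `p` divides the `n`-th
Fibonacci polynomial. -/
def HasFibIndex (p : (ZMod 2)[X]) (N : ℕ) : Prop :=
  IsLeast {n : ℕ | 0 < n ∧ p ∣ fibPoly n} N

end

end CyclicMUB

/-!
A class of commuting Pauli operators corresponds to a Lagrangian subspace of the symplectic space
`𝔽₂²ᵐ`. Three facts about such classes carry the theorem.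

* The Pauli operators form an orthogonal basis of the matrix space, so
  `d * |⟨u, v⟩|² = ∑ₐ conj ⟨u, Pₐ u⟩ * ⟨v, Pₐ v⟩` (`sum_star_expect_mul_expect`). If `u` is a common
  eigenvector of a Lagrangian class, `⟨u, Pₐ u⟩` vanishes for all `a` outside the Lagrangian
  subspace, because `Pₐ` anticommutes with a member of the class (`IsEigenbasis.expect_eq_zero`).
* If two Lagrangian subspaces meet in zero, only `a = 0` contributes, which gives mutual unbiasedness
  (`IsEigenbasis.mutuallyUnbiased`). If they coincide, then non-orthogonal `u` and `v` have the same
  eigenvalues, and `|⟨u, v⟩| = 1`; hence two eigenbases of one class differ by a monomial matrix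
  (`IsEigenbasis.exists_eq_mul_isMonomial`).
* An orthogonal matrix `T` over `𝔽₂` acts by the permutation `|j⟩ ↦ |T j⟩`, which maps the Pauli
  operator of `(z | x)` to a scalar multiple of that of `(T z | T x)` (`pauli_mul_basisPerm`).

As `p` is irreducible, `q ↦ q(B)` represents the field `K = 𝔽₂[X] / p` by symmetric matrices, and the
standard classes come from the Lagrangian subspaces `(1, 0)` and `(x, 1)`, `x ∈ K`. Differences of
distinct field elements are invertible, so these meet pairwise in zero (`isSpread_fieldGenerator`).
The representations given by `B` and `B'` are conjugate by an orthogonal matrix, because every element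
of a finite field of characteristic two is a square (`exists_orthogonal_conj`). This proves the claims
for the standard classes.

The `k`-th cyclic class is generated by `(F_{k+1}(B), F_k(B))`, thus by `(F_{k+1} / F_k, 1)` over `K`.
By d'Ocagne's identity these ratios are distinct for `0 ≤ k ≤ d` when the Fibonacci index is `d + 1`,
so by counting, the cyclic classes are exactly the standard ones
(`cyclicClasses_eq_standardClasses`).
-/

namespace CyclicMUB

open Matrix Polynomial

noncomputable section

variable {m : ℕ}

/-! ### Signs and entries of Pauli operators -/

/-- The nontrivial additive character `t ↦ (-1) ^ t` of `𝔽₂`. -/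
def sgn (t : ZMod 2) : ℂ := (-1) ^ t.val

@[simp] lemma sgn_zero : sgn 0 = 1 := by simp [sgn]

@[simp] lemma sgn_one : sgn 1 = -1 := by simp [sgn, ZMod.val_one]

lemma zmod_two_cases (t : ZMod 2) : t = 0 ∨ t = 1 := by
  revert t; decide

lemma zmod_two_add_self (t : ZMod 2) : t + t = 0 := CharTwo.add_self_eq_zero t

lemma sgn_add (s t : ZMod 2) : sgn (s + t) = sgn s * sgn t := by
  rcases zmod_two_cases s with rfl | rfl <;> rcases zmod_two_cases t with rfl | rfl <;>
    simp [zmod_two_add_self]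

lemma sgn_mul_self (t : ZMod 2) : sgn t * sgn t = 1 := by
  rw [← sgn_add, zmod_two_add_self, sgn_zero]

lemma star_sgn (t : ZMod 2) : star (sgn t) = sgn t := by
  rcases zmod_two_cases t with rfl | rfl <;> simp

lemma sgn_injective : Function.Injective sgn := by
  intro s t h
  rcases zmod_two_cases s with rfl | rfl <;> rcases zmod_two_cases t with rfl | rfl <;>
    first | rfl | norm_num at h

lemma sgn_sum {ι : Type*} (s : Finset ι) (f : ι → ZMod 2) :
    sgn (∑ k ∈ s, f k) = ∏ k ∈ s, sgn (f k) := by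
  classical
  induction s using Finset.induction_on with
  | empty => simp
  | insert a s ha ih => rw [Finset.sum_insert ha, Finset.prod_insert ha, sgn_add, ih]

/-- The `z`-part of a vector `(a_z | a_x)`. -/
abbrev zPart (a : Fin m ⊕ Fin m → ZMod 2) : Fin m → ZMod 2 := a ∘ Sum.inl

/-- The `x`-part of a vector `(a_z | a_x)`. -/
abbrev xPart (a : Fin m ⊕ Fin m → ZMod 2) : Fin m → ZMod 2 := a ∘ Sum.inr

lemma qubits_add_self (v : Qubits m) : v + v = 0 := by
  ext k
  exact zmod_two_add_self (v k)

lemma qubits_eq_add_iff {i j v : Qubits m} : i = j + v ↔ j = i + v := by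
  constructor <;> rintro rfl <;> simp [add_assoc, qubits_add_self]

/-- The scalar factor `∏ₖ i ^ (a_x k * a_z k)` of the Pauli operator of `a`. -/
def phase (a : Fin m ⊕ Fin m → ZMod 2) : ℂ :=
  ∏ k : Fin m, Complex.I ^ ((a (Sum.inr k)).val * (a (Sum.inl k)).val)

lemma star_phase_mul_phase (a : Fin m ⊕ Fin m → ZMod 2) : star (phase a) * phase a = 1 := by
  simp only [phase, Complex.star_def, map_prod, ← Finset.prod_mul_distrib]
  refine Finset.prod_eq_one fun k _ => ?_
  rw [map_pow, ← mul_pow]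
  simp

lemma phase_ne_zero (a : Fin m ⊕ Fin m → ZMod 2) : phase a ≠ 0 :=
  right_ne_zero_of_mul (by rw [star_phase_mul_phase]; exact one_ne_zero)

lemma phase_mul_phase (a : Fin m ⊕ Fin m → ZMod 2) :
    phase a * phase a = sgn (zPart a ⬝ᵥ xPart a) := by
  simp only [phase, dotProduct, sgn_sum, ← Finset.prod_mul_distrib, Function.comp_apply]
  refine Finset.prod_congr rfl fun k _ => ?_
  rcases zmod_two_cases (a (Sum.inr k)) with h | h <;>
    rcases zmod_two_cases (a (Sum.inl k)) with h' | h' <;> simp [h, h', ZMod.val_one]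

lemma star_phase (a : Fin m ⊕ Fin m → ZMod 2) :
    star (phase a) = phase a * sgn (zPart a ⬝ᵥ xPart a) := by
  have h : star (phase a) * (phase a * phase a) = phase a := by
    rw [← mul_assoc, star_phase_mul_phase, one_mul]
  rw [phase_mul_phase] at h
  linear_combination sgn (zPart a ⬝ᵥ xPart a) * h -
    star (phase a) * sgn_mul_self (zPart a ⬝ᵥ xPart a)

lemma pauliX_pow_mul_pauliZ_pow (x z i j : ZMod 2) :
    (pauliX ^ x.val * pauliZ ^ z.val) i j = if i = j + x then sgn (z * j) else 0 := by
  have hz : ∀ i j, (pauliZ ^ z.val) i j = if i = j then sgn (z * j) else 0 := by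
    intro i j
    rcases zmod_two_cases z with rfl | rfl <;>
      simp [pauliZ, ZMod.val_one, Matrix.one_apply, Matrix.diagonal_apply, sgn]
    by_cases h : i = j <;> simp [h]
  have hx : ∀ i j, (pauliX ^ x.val) i j = if i = j + x then 1 else 0 := by
    intro i j
    rcases zmod_two_cases x with rfl | rfl <;>
      simp [pauliX, ZMod.val_one, Matrix.one_apply]
  rw [Matrix.mul_apply]
  simp [hx, hz]

/-- The Pauli operator of `a` maps `|j⟩` to a multiple of `|j + a_x⟩`. -/
lemma pauli_apply (a : Fin m ⊕ Fin m → ZMod 2) (i j : Qubits m) :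
    pauli a i j = if i = j + xPart a then phase a * sgn (zPart a ⬝ᵥ j) else 0 := by
  simp only [pauli, Matrix.of_apply, Matrix.smul_apply, smul_eq_mul, pauliX_pow_mul_pauliZ_pow,
    Finset.prod_mul_distrib]
  rw [Fintype.prod_ite_zero]
  simp only [dotProduct, sgn_sum, phase, mul_ite, mul_zero, funext_iff, Pi.add_apply,
    Function.comp_apply]

lemma pauli_zero : pauli (0 : Fin m ⊕ Fin m → ZMod 2) = 1 := by
  ext i j
  simp [pauli_apply, phase, Matrix.one_apply]

/-- The symplectic form on `𝔽₂²ᵐ`, which measures whether two Pauli operators commute. -/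
def symp (a b : Fin m ⊕ Fin m → ZMod 2) : ZMod 2 :=
  zPart a ⬝ᵥ xPart b + xPart a ⬝ᵥ zPart b

lemma pauli_mul_apply (a b : Fin m ⊕ Fin m → ZMod 2) (i j : Qubits m) :
    (pauli a * pauli b) i j = if i = j + (xPart a + xPart b) then
      phase a * phase b * sgn (zPart a ⬝ᵥ xPart b) * sgn (zPart a ⬝ᵥ j) * sgn (zPart b ⬝ᵥ j)
      else 0 := by
  simp only [Matrix.mul_apply, pauli_apply, mul_ite, mul_zero, Finset.sum_ite_eq',
    Finset.mem_univ, if_true, dotProduct_add, sgn_add, add_assoc,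
    add_comm (xPart b)]
  split_ifs
  · ring
  · simp

/-- Pauli operators commute or anticommute, according to the symplectic form. -/
lemma pauli_mul_pauli (a b : Fin m ⊕ Fin m → ZMod 2) :
    pauli a * pauli b = sgn (symp a b) • (pauli b * pauli a) := by
  ext i j
  rw [Matrix.smul_apply, pauli_mul_apply, pauli_mul_apply, add_comm (xPart b), symp, sgn_add,
    dotProduct_comm (xPart a)]
  split_ifs
  · linear_combination (-phase a * phase b * sgn (zPart a ⬝ᵥ xPart b) * sgn (zPart a ⬝ᵥ j) *
      sgn (zPart b ⬝ᵥ j)) * sgn_mul_self (zPart b ⬝ᵥ xPart a)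
  · simp

lemma pauli_mul_self (a : Fin m ⊕ Fin m → ZMod 2) : pauli a * pauli a = 1 := by
  ext i j
  rw [pauli_mul_apply, qubits_add_self (xPart a), add_zero, Matrix.one_apply]
  refine if_congr Iff.rfl ?_ rfl
  rw [phase_mul_phase, sgn_mul_self, one_mul, sgn_mul_self]

lemma conjTranspose_pauli (a : Fin m ⊕ Fin m → ZMod 2) : (pauli a)ᴴ = pauli a := by
  ext i j
  have h : j = i + xPart a ↔ i = j + xPart a := by
    constructor <;> rintro rfl <;> simp [add_assoc, qubits_add_self (xPart a)]
  rw [Matrix.conjTranspose_apply, pauli_apply, pauli_apply]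
  by_cases hi : i = j + xPart a
  · rw [if_pos hi, if_pos (h.2 hi), star_mul', star_sgn, star_phase, hi, dotProduct_add, sgn_add]
    linear_combination (phase a * sgn (zPart a ⬝ᵥ j)) * sgn_mul_self (zPart a ⬝ᵥ xPart a)
  · rw [if_neg hi, if_neg (mt h.1 hi), star_zero]

lemma pauli_injective : Function.Injective (pauli (m := m)) := by
  intro a b hab
  have hx : xPart a = xPart b := by
    by_contra hne
    have h := congrFun₂ hab (xPart a) 0
    simp only [pauli_apply, zero_add, if_true, if_neg hne, dotProduct_zero, sgn_zero,
      mul_one] at h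
    exact phase_ne_zero a h
  have key : ∀ j : Qubits m, phase a * sgn (zPart a ⬝ᵥ j) = phase b * sgn (zPart b ⬝ᵥ j) := by
    intro j
    have h := congrFun₂ hab (j + xPart a) j
    simpa only [pauli_apply, if_true, hx] using h
  have hphase : phase a = phase b := by simpa using key 0
  have hz : zPart a = zPart b := by
    ext k
    have h := key (Pi.single k 1)
    rw [hphase] at h
    simpa using sgn_injective (mul_left_cancel₀ (phase_ne_zero b) h)
  funext s
  rcases s with k | k
  · exact congrFun hz k
  · exact congrFun hx k

/-! ### Orthogonality of the Pauli operators -/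

lemma sum_sgn_dotProduct (w : Fin m → ZMod 2) :
    ∑ z : Fin m → ZMod 2, sgn (z ⬝ᵥ w) = if w = 0 then 2 ^ m else 0 := by
  simp only [dotProduct, sgn_sum]
  rw [← Fintype.prod_sum (fun (k : Fin m) (t : ZMod 2) => sgn (t * w k))]
  have h : ∀ k, ∑ t : ZMod 2, sgn (t * w k) = if w k = 0 then 2 else 0 := by
    intro k
    have : ∀ f : ZMod 2 → ℂ, ∑ t, f t = f 0 + f 1 := fun f => Fin.sum_univ_two f
    rw [this]
    rcases zmod_two_cases (w k) with h | h <;> simp [h]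
    norm_num
  simp only [h, Fintype.prod_ite_zero, Finset.prod_const, Finset.card_univ, Fintype.card_fin,
    funext_iff, Pi.zero_apply]

lemma sum_star_pauli_mul_pauli (i j k l : Qubits m) :
    ∑ a : Fin m ⊕ Fin m → ZMod 2, star (pauli a i j) * pauli a k l =
      if i = k ∧ j = l then 2 ^ m else 0 := by
  have h1 : ∀ a : Fin m ⊕ Fin m → ZMod 2, star (pauli a i j) * pauli a k l =
      if xPart a = i + j then (if k = l + (i + j) then sgn (zPart a ⬝ᵥ (j + l)) else 0)
        else 0 := by
    intro a
    have h : i = j + xPart a ↔ xPart a = i + j := by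
      rw [add_comm j, qubits_eq_add_iff]
    rw [pauli_apply, pauli_apply]
    by_cases hi : xPart a = i + j
    · rw [if_pos (h.2 hi), if_pos hi, hi]
      split_ifs
      · rw [star_mul', star_sgn, dotProduct_add, sgn_add]
        linear_combination (sgn (zPart a ⬝ᵥ j) * sgn (zPart a ⬝ᵥ l)) * star_phase_mul_phase a
      · simp
    · rw [if_neg (mt h.1 hi), if_neg hi]; simp
  simp only [h1]
  rw [← (Equiv.sumArrowEquivProdArrow (Fin m) (Fin m) (ZMod 2)).symm.sum_comp,
    Fintype.sum_prod_type]
  have h2 : ∀ z x : Fin m → ZMod 2,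
      xPart ((Equiv.sumArrowEquivProdArrow (Fin m) (Fin m) (ZMod 2)).symm (z, x)) = x :=
    fun z x => rfl
  have h3 : ∀ z x : Fin m → ZMod 2,
      zPart ((Equiv.sumArrowEquivProdArrow (Fin m) (Fin m) (ZMod 2)).symm (z, x)) = z :=
    fun z x => rfl
  simp only [h2, h3, Finset.sum_ite_eq', Finset.mem_univ, if_true]
  have h4 : j + l = 0 ↔ j = l := by rw [eq_comm, ← qubits_eq_add_iff, zero_add]
  by_cases hjl : j = l
  · subst hjl
    have h5 : k = j + (i + j) ↔ i = k := by
      rw [add_comm i j, ← add_assoc, qubits_add_self j, zero_add, eq_comm]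
    simp only [h5, and_true]
    split_ifs
    · rw [sum_sgn_dotProduct, if_pos (h4.2 rfl)]
    · simp
  · rw [if_neg (fun h => hjl h.2)]
    split_ifs
    · rw [sum_sgn_dotProduct, if_neg (mt h4.1 hjl)]
    · simp

/-- The expectation value `⟨u, A u⟩`. -/
def expect (A : Matrix (Qubits m) (Qubits m) ℂ) (u : Qubits m → ℂ) : ℂ := star u ⬝ᵥ A *ᵥ u

/-- Parseval's identity for the rank one operators `|u⟩⟨u|` and `|v⟩⟨v|`, expanded in the
orthogonal basis of Pauli operators. -/
lemma sum_star_expect_mul_expect (u v : Qubits m → ℂ) :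
    ∑ a, star (expect (pauli a) u) * expect (pauli a) v =
      2 ^ m * (star (star u ⬝ᵥ v) * (star u ⬝ᵥ v)) := by
  have h1 : ∀ (A : Matrix (Qubits m) (Qubits m) ℂ) (w : Qubits m → ℂ),
      expect A w = ∑ p : Qubits m × Qubits m, star (w p.1) * w p.2 * A p.1 p.2 := by
    intro A w
    simp only [expect, dotProduct, Matrix.mulVec, Fintype.sum_prod_type, Finset.mul_sum,
      Pi.star_apply]
    refine Finset.sum_congr rfl fun i _ => Finset.sum_congr rfl fun j _ => ?_
    ring
  have h2 : ∀ a : Fin m ⊕ Fin m → ZMod 2, star (expect (pauli a) u) * expect (pauli a) v =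
      ∑ p : Qubits m × Qubits m, ∑ q : Qubits m × Qubits m,
        (u p.1 * star (u p.2) * (star (v q.1) * v q.2)) *
          (star (pauli a p.1 p.2) * pauli a q.1 q.2) := by
    intro a
    simp only [h1, star_sum, Finset.sum_mul_sum, star_mul', star_star]
    refine Finset.sum_congr rfl fun i _ => Finset.sum_congr rfl fun j _ => ?_
    ring
  have h3 : ∀ p q : Qubits m × Qubits m, (p.1 = q.1 ∧ p.2 = q.2) ↔ p = q :=
    fun p q => Prod.ext_iff.symm
  simp only [h2]
  rw [Finset.sum_comm]
  conv_lhs => enter [2, p]; rw [Finset.sum_comm]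
  simp only [← Finset.mul_sum, sum_star_pauli_mul_pauli, h3, mul_ite, mul_zero,
    Finset.sum_ite_eq, Finset.mem_univ, if_true, Fintype.sum_prod_type, dotProduct, star_sum,
    Finset.sum_mul_sum, star_mul', Pi.star_apply, star_star]
  simp only [Finset.mul_sum]
  refine Finset.sum_congr rfl fun i _ => Finset.sum_congr rfl fun j _ => ?_
  ring

/-! ### Overlaps of common eigenvectors -/

/-- The column space of `G` is its own orthogonal complement for the symplectic form. -/
def IsLagrangian (G : Matrix (Fin m ⊕ Fin m) (Fin m) (ZMod 2)) : Prop :=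
  ∀ a, (∀ c, symp a (G *ᵥ c) = 0) ↔ ∃ c, a = G *ᵥ c

lemma star_dotProduct_col (U : Matrix.unitaryGroup (Qubits m) ℂ) (j : Qubits m) :
    star ((U : Matrix (Qubits m) (Qubits m) ℂ).col j) ⬝ᵥ
      (U : Matrix (Qubits m) (Qubits m) ℂ).col j = 1 := by
  have h := congrFun₂ (Matrix.mem_unitaryGroup_iff'.1 U.2) j j
  simpa [Matrix.mul_apply, dotProduct, Matrix.star_apply] using h

lemma star_mulVec_dotProduct {A : Matrix (Qubits m) (Qubits m) ℂ} (hA : Aᴴ = A)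
    (u w : Qubits m → ℂ) : star (A *ᵥ u) ⬝ᵥ w = star u ⬝ᵥ A *ᵥ w := by
  rw [Matrix.star_mulVec, hA, Matrix.dotProduct_mulVec]

lemma IsEigenbasis.exists_eigenvalue {G : Matrix (Fin m ⊕ Fin m) (Fin m) (ZMod 2)}
    {U : Matrix.unitaryGroup (Qubits m) ℂ} (hU : IsEigenbasis (pauliClass G) U)
    (j : Qubits m) (c : Fin m → ZMod 2) :
    ∃ μ : ℂ, star μ = μ ∧ μ ≠ 0 ∧
      pauli (G *ᵥ c) *ᵥ (U : Matrix (Qubits m) (Qubits m) ℂ).col j =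
        μ • (U : Matrix (Qubits m) (Qubits m) ℂ).col j := by
  by_cases hc : c = 0
  · refine ⟨1, star_one _, one_ne_zero, ?_⟩
    rw [hc, Matrix.mulVec_zero, pauli_zero, Matrix.one_mulVec, one_smul]
  obtain ⟨μ, hμ⟩ := hU _ ⟨c, hc, rfl⟩ j
  change pauli (G *ᵥ c) *ᵥ (U : Matrix (Qubits m) (Qubits m) ℂ).col j =
        μ • (U : Matrix (Qubits m) (Qubits m) ℂ).col j at hμ
  have hsq : μ * μ = 1 := by
    have h := congrArg (pauli (G *ᵥ c) *ᵥ ·) hμ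
    beta_reduce at h
    rw [Matrix.mulVec_mulVec, pauli_mul_self, Matrix.one_mulVec, Matrix.mulVec_smul, hμ] at h
    have h' := congrArg (star ((U : Matrix (Qubits m) (Qubits m) ℂ).col j) ⬝ᵥ ·) h
    simpa only [dotProduct_smul, star_dotProduct_col, smul_eq_mul, mul_one] using h'.symm
  refine ⟨μ, ?_, left_ne_zero_of_mul (hsq.symm ▸ one_ne_zero), hμ⟩
  rcases mul_self_eq_one_iff.1 hsq with rfl | rfl <;> simp

/-- A Pauli operator outside a maximal commuting class anticommutes with a member of the class, so
its expectation value vanishes at the common eigenvectors of the class. -/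
lemma IsEigenbasis.expect_eq_zero {G : Matrix (Fin m ⊕ Fin m) (Fin m) (ZMod 2)}
    (hG : IsLagrangian G) {U : Matrix.unitaryGroup (Qubits m) ℂ}
    (hU : IsEigenbasis (pauliClass G) U) (j : Qubits m) {a : Fin m ⊕ Fin m → ZMod 2}
    (ha : ¬∃ c, a = G *ᵥ c) :
    expect (pauli a) ((U : Matrix (Qubits m) (Qubits m) ℂ).col j) = 0 := by
  rw [← hG a] at ha
  push Not at ha
  obtain ⟨c, hc⟩ := ha
  obtain ⟨μ, hreal, hne, hμ⟩ := hU.exists_eigenvalue j c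
  have h := pauli_mul_pauli a (G *ᵥ c)
  rw [(zmod_two_cases _).resolve_left hc, sgn_one] at h
  have h' := congrArg (fun A => expect A ((U : Matrix (Qubits m) (Qubits m) ℂ).col j)) h
  simp only [expect, neg_smul, one_smul, Matrix.neg_mulVec, ← Matrix.mulVec_mulVec, hμ,
    dotProduct_neg] at h'
  rw [← star_mulVec_dotProduct (conjTranspose_pauli (G *ᵥ c)), hμ, Matrix.mulVec_smul, star_smul,
    hreal, dotProduct_smul, smul_dotProduct, ← smul_neg] at h'
  exact CharZero.eq_neg_self_iff.1 (smul_right_injective ℂ hne h')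

/-- Eigenbases of classes that share only the identity are mutually unbiased. -/
lemma IsEigenbasis.mutuallyUnbiased {G G' : Matrix (Fin m ⊕ Fin m) (Fin m) (ZMod 2)}
    (hG : IsLagrangian G) (hG' : IsLagrangian G')
    (hGG' : ∀ c c', G *ᵥ c = G' *ᵥ c' → G *ᵥ c = 0) {U V : Matrix.unitaryGroup (Qubits m) ℂ}
    (hU : IsEigenbasis (pauliClass G) U) (hV : IsEigenbasis (pauliClass G') V) :
    MutuallyUnbiased U V := by
  intro i j
  set u := (U : Matrix (Qubits m) (Qubits m) ℂ).col i with hu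
  set v := (V : Matrix (Qubits m) (Qubits m) ℂ).col j with hv
  -- Only the identity contributes to Parseval's sum.
  have h := sum_star_expect_mul_expect u v
  rw [Fintype.sum_eq_single 0] at h
  · simp only [expect, pauli_zero, Matrix.one_mulVec, hu, hv, star_dotProduct_col, star_one,
      mul_one, Complex.star_def, Complex.conj_mul'] at h
    have h' : (1 : ℝ) = 2 ^ m * ‖star u ⬝ᵥ v‖ ^ 2 := by exact_mod_cast h
    have hcard : (Fintype.card (Qubits m) : ℝ) = 2 ^ m := by simp
    rw [hcard, eq_div_iff (by positivity), mul_comm, h']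
    rfl
  · intro a ha
    by_cases h1 : ∃ c, a = G *ᵥ c
    · have h2 : ¬∃ c, a = G' *ᵥ c := by
        rintro ⟨c', hc'⟩
        obtain ⟨c, rfl⟩ := h1
        exact ha (hGG' c c' hc')
      rw [hV.expect_eq_zero hG' j h2, mul_zero]
    · rw [hU.expect_eq_zero hG i h1, star_zero, zero_mul]

/-- Non-orthogonal common eigenvectors of a maximal commuting class have the same eigenvalues, hence
the same expectation values of all Pauli operators, hence agree up to a scalar. -/
lemma IsEigenbasis.norm_overlap_eq_one {G : Matrix (Fin m ⊕ Fin m) (Fin m) (ZMod 2)}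
    (hG : IsLagrangian G) {U V : Matrix.unitaryGroup (Qubits m) ℂ}
    (hU : IsEigenbasis (pauliClass G) U) (hV : IsEigenbasis (pauliClass G) V) {i j : Qubits m}
    (hij : star ((U : Matrix (Qubits m) (Qubits m) ℂ).col i) ⬝ᵥ
      (V : Matrix (Qubits m) (Qubits m) ℂ).col j ≠ 0) :
    ‖star ((U : Matrix (Qubits m) (Qubits m) ℂ).col i) ⬝ᵥ
      (V : Matrix (Qubits m) (Qubits m) ℂ).col j‖ = 1 := by
  set u := (U : Matrix (Qubits m) (Qubits m) ℂ).col i with hu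
  set v := (V : Matrix (Qubits m) (Qubits m) ℂ).col j with hv
  have key : ∀ a, expect (pauli a) v = expect (pauli a) u := by
    intro a
    by_cases h : ∃ c, a = G *ᵥ c
    · obtain ⟨c, rfl⟩ := h
      obtain ⟨μ, hμr, -, hμ⟩ := hU.exists_eigenvalue i c
      obtain ⟨ν, -, -, hν⟩ := hV.exists_eigenvalue j c
      have h := star_mulVec_dotProduct (conjTranspose_pauli (G *ᵥ c)) u v
      rw [hμ, hν, star_smul, hμr, dotProduct_smul, smul_dotProduct] at h
      rw [expect, expect, hμ, hν, dotProduct_smul, dotProduct_smul, hu, hv, star_dotProduct_col,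
        star_dotProduct_col, mul_right_cancel₀ hij h]
    · rw [hU.expect_eq_zero hG i h, hV.expect_eq_zero hG j h]
  have h := sum_star_expect_mul_expect u v
  simp only [key] at h
  rw [sum_star_expect_mul_expect u u, hu, star_dotProduct_col, ← hu] at h
  have h' := mul_left_cancel₀ (pow_ne_zero m two_ne_zero) h
  rw [star_one, mul_one, Complex.star_def, Complex.conj_mul'] at h'
  have h2 : (1 : ℝ) = ‖star u ⬝ᵥ v‖ ^ 2 := by exact_mod_cast h'
  exact (pow_eq_one_iff_of_nonneg (norm_nonneg _) two_ne_zero).1 h2.symm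

/-! ### Monomial matrices -/

/-- A unitary matrix whose entries have modulus zero or one is monomial. -/
lemma isMonomial_of_norm_eq_one {n : Type*} [Fintype n] [DecidableEq n]
    (W : Matrix.unitaryGroup n ℂ)
    (h : ∀ i j, (W : Matrix n n ℂ) i j ≠ 0 → ‖(W : Matrix n n ℂ) i j‖ = 1) :
    IsMonomial (W : Matrix n n ℂ) := by
  have hrow : ∀ i, ∑ j, ‖(W : Matrix n n ℂ) i j‖ ^ 2 = 1 := by
    intro i
    have h := congrFun₂ (Matrix.mem_unitaryGroup_iff.1 W.2) i i
    simp only [Matrix.mul_apply, Matrix.star_apply, Complex.star_def, Complex.mul_conj',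
      Matrix.one_apply_eq] at h
    exact_mod_cast h
  have hcol : ∀ j, ∑ i, ‖(W : Matrix n n ℂ) i j‖ ^ 2 = 1 := by
    intro j
    have h := congrFun₂ (Matrix.mem_unitaryGroup_iff'.1 W.2) j j
    simp only [Matrix.mul_apply, Matrix.star_apply, Complex.star_def, Complex.conj_mul',
      Matrix.one_apply_eq] at h
    exact_mod_cast h
  -- A sum of squares equal to one has at most one term of modulus one.
  have huniq : ∀ f : n → ℂ, ∑ i, ‖f i‖ ^ 2 = 1 → ∀ i j, ‖f i‖ = 1 → ‖f j‖ = 1 → i = j := by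
    intro f hf i j hi hj
    by_contra hne
    have h2 : ∑ k ∈ {i, j}, ‖f k‖ ^ 2 ≤ ∑ k, ‖f k‖ ^ 2 :=
      Finset.sum_le_sum_of_subset_of_nonneg (Finset.subset_univ _) fun _ _ _ => by positivity
    rw [hf, Finset.sum_pair hne, hi, hj] at h2
    norm_num at h2
  have hex : ∀ i, ∃ j, ‖(W : Matrix n n ℂ) i j‖ = 1 := by
    intro i
    obtain ⟨j, -, hj⟩ := Finset.exists_ne_zero_of_sum_ne_zero (hrow i ▸ one_ne_zero)
    exact ⟨j, h i j fun h0 => hj (by rw [h0]; simp)⟩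
  choose σ hσ using hex
  have hinj : Function.Injective σ := fun i i' hii' =>
    huniq (fun k => (W : Matrix n n ℂ) k (σ i)) (hcol _) i i' (hσ i) (hii' ▸ hσ i')
  refine ⟨fun i => (W : Matrix n n ℂ) i (σ i),
    Equiv.ofBijective σ (Finite.injective_iff_bijective.1 hinj), hσ, ?_⟩
  ext i j
  rw [Matrix.diagonal_mul]
  by_cases hj : σ i = j
  · simp [Equiv.Perm.permMatrix, PEquiv.toMatrix_apply, hj]
  · have h0 : (W : Matrix n n ℂ) i j = 0 := by
      by_contra h0
      exact hj (huniq _ (hrow i) _ _ (hσ i) (h i j h0))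
    simp [Equiv.Perm.permMatrix, PEquiv.toMatrix_apply, hj, h0]

/-- The eigenbasis of a maximal commuting class is unique up to monomial matrices. -/
lemma IsEigenbasis.exists_eq_mul_isMonomial {G : Matrix (Fin m ⊕ Fin m) (Fin m) (ZMod 2)}
    (hG : IsLagrangian G) {U V : Matrix.unitaryGroup (Qubits m) ℂ}
    (hU : IsEigenbasis (pauliClass G) U) (hV : IsEigenbasis (pauliClass G) V) :
    ∃ W : Matrix (Qubits m) (Qubits m) ℂ, IsMonomial W ∧
      (V : Matrix (Qubits m) (Qubits m) ℂ) = (U : Matrix (Qubits m) (Qubits m) ℂ) * W := by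
  refine ⟨(U⁻¹ * V : Matrix.unitaryGroup (Qubits m) ℂ), isMonomial_of_norm_eq_one _ ?_, ?_⟩
  · intro i j hij
    exact hU.norm_overlap_eq_one hG hV hij
  · rw [← Matrix.UnitaryGroup.mul_val, mul_inv_cancel_left]

/-! ### Existence of eigenbases -/

lemma exists_orthonormalBasis_eigenvectors_of_commute {E n ι : Type*} [NormedAddCommGroup E]
    [InnerProductSpace ℂ E] [FiniteDimensional ℂ E] [Fintype n]
    (hn : Module.finrank ℂ E = Fintype.card n) (T : ι → E →ₗ[ℂ] E)
    (hT : ∀ i, (T i).IsSymmetric) (hC : Pairwise (Function.onFun Commute T)) :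
    ∃ b : OrthonormalBasis n ℂ E, ∀ i j, ∃ μ : ℂ, T i (b j) = μ • b j := by
  classical
  have hint := LinearMap.IsSymmetric.directSum_isInternal_of_pairwise_commute hT hC
  have horth := LinearMap.IsSymmetric.orthogonalFamily_iInf_eigenspaces hT
  -- Only finitely many joint eigenspaces are nonzero.
  have hfin := WellFoundedGT.finite_ne_bot_of_iSupIndep hint.submodule_iSupIndep
  have hint' := DirectSum.isInternal_ne_bot_iff.2 hint
  have : Fintype {χ : ι → ℂ // (⨅ i, Module.End.eigenspace (T i) (χ i)) ≠ ⊥} := hfin.fintype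
  have horth' := horth.comp (Subtype.val_injective
    (p := fun χ : ι → ℂ => (⨅ i, Module.End.eigenspace (T i) (χ i)) ≠ ⊥))
  refine ⟨(hint'.subordinateOrthonormalBasis hn horth').reindex
    (Fintype.equivOfCardEq (Fintype.card_fin _)), fun i j => ?_⟩
  rw [OrthonormalBasis.reindex_apply]
  have h := hint'.subordinateOrthonormalBasis_subordinate hn
    ((Fintype.equivOfCardEq (Fintype.card_fin _)).symm j) horth'
  exact ⟨_, Module.End.mem_eigenspace_iff.1 ((Submodule.mem_iInf _).1 h i)⟩

/-- Commuting Hermitian matrices have an orthonormal basis of common eigenvectors. -/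
lemma exists_isEigenbasis_of_commute {n ι : Type*} [Fintype n] [DecidableEq n]
    (A : ι → Matrix n n ℂ) (hA : ∀ i, (A i).IsHermitian) (hcomm : ∀ i j, Commute (A i) (A j)) :
    ∃ U : Matrix.unitaryGroup n ℂ, IsEigenbasis (Set.range A) U := by
  obtain ⟨b, hb⟩ := exists_orthonormalBasis_eigenvectors_of_commute
    (n := n) (E := EuclideanSpace ℂ n) finrank_euclideanSpace (fun i => (A i).toEuclideanLin)
    (fun i => Matrix.isSymmetric_toEuclideanLin_iff.2 (hA i)) (by
      intro i j _
      refine LinearMap.ext fun v => ?_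
      simp only [Module.End.mul_apply, Matrix.toLpLin_apply, Matrix.mulVec_mulVec,
        (hcomm i j).eq])
  refine ⟨⟨(EuclideanSpace.basisFun n ℂ).toBasis.toMatrix b.toBasis,
    (EuclideanSpace.basisFun n ℂ).toMatrix_orthonormalBasis_mem_unitary b⟩, ?_⟩
  rintro _ ⟨i, rfl⟩ j
  obtain ⟨μ, hμ⟩ := hb i j
  refine ⟨μ, ?_⟩
  have h := congrArg WithLp.ofLp hμ
  rw [Matrix.toLpLin_apply] at h
  exact h

/-- The Pauli operators of a maximal commuting class have an eigenbasis. -/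
lemma IsLagrangian.exists_isEigenbasis {G : Matrix (Fin m ⊕ Fin m) (Fin m) (ZMod 2)}
    (hG : IsLagrangian G) : ∃ U, IsEigenbasis (pauliClass G) U := by
  obtain ⟨U, hU⟩ := exists_isEigenbasis_of_commute (fun c => pauli (G *ᵥ c))
    (fun c => conjTranspose_pauli _) (fun c c' => by
      rw [commute_iff_eq, pauli_mul_pauli, (hG _).2 ⟨c, rfl⟩ c', sgn_zero, one_smul])
  refine ⟨U, ?_⟩
  rintro _ ⟨c, -, rfl⟩
  exact hU _ ⟨c, rfl⟩

/-! ### Families of Lagrangian subspaces that meet pairwise in zero -/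

/-- The columns of the matrices `G k` span `2 ^ m + 1` Lagrangian subspaces of dimension `m` that
meet pairwise in zero: a symplectic spread of `𝔽₂²ᵐ`. For `m = 0` all classes would be empty and
could not be distinguished, hence the field `pos`. -/
structure IsSpread {κ : Type*} (G : κ → Matrix (Fin m ⊕ Fin m) (Fin m) (ZMod 2)) : Prop where
  pos : 0 < m
  card : Nat.card κ = 2 ^ m + 1
  lagrangian : ∀ k, IsLagrangian (G k)
  injective : ∀ k, Function.Injective (G k *ᵥ ·)
  disjoint : ∀ k l, k ≠ l → ∀ c c', G k *ᵥ c = G l *ᵥ c' → G k *ᵥ c = 0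

namespace IsSpread

variable {κ : Type*} {G G' : κ → Matrix (Fin m ⊕ Fin m) (Fin m) (ZMod 2)}

lemma pauliClass_injective (hG : IsSpread G) :
    Function.Injective fun k => pauliClass (G k) := by
  intro k l hkl
  by_contra hne
  have : Nonempty (Fin m) := ⟨⟨0, hG.pos⟩⟩
  obtain ⟨c, hc⟩ := exists_ne (0 : Fin m → ZMod 2)
  have hmem : pauli (G k *ᵥ c) ∈ pauliClass (G k) := ⟨c, hc, rfl⟩
  beta_reduce at hkl
  rw [hkl] at hmem
  obtain ⟨c', -, h⟩ := hmem
  have h0 := hG.disjoint k l hne c c' (pauli_injective h)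
  exact hc (hG.injective k (by simpa using h0))

/-- An enumeration of the classes amounts to an enumeration of the index set of the spread. -/
lemma exists_equiv_of_range_eq (hG : IsSpread G)
    {𝒞 : Fin (2 ^ m + 1) → Set (Matrix (Qubits m) (Qubits m) ℂ)} (hinj : Function.Injective 𝒞)
    (hrange : Set.range 𝒞 = Set.range fun k => pauliClass (G k)) :
    ∃ o : Fin (2 ^ m + 1) ≃ κ, ∀ k, 𝒞 k = pauliClass (G (o k)) := by
  have h : ∀ k, ∃ l, pauliClass (G l) = 𝒞 k := fun k => by
    have hk : 𝒞 k ∈ Set.range 𝒞 := Set.mem_range_self k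
    rwa [hrange] at hk
  choose o ho using h
  refine ⟨Equiv.ofBijective o ⟨fun k l hkl => hinj ?_, fun l => ?_⟩, fun k => (ho k).symm⟩
  · rw [← ho, ← ho, hkl]
  · obtain ⟨k, hk⟩ : pauliClass (G l) ∈ Set.range 𝒞 := hrange ▸ Set.mem_range_self l
    exact ⟨k, hG.pauliClass_injective ((ho k).trans hk)⟩

lemma generatesCompleteMUB (hG : IsSpread G) :
    GeneratesCompleteMUB (Set.range fun k => pauliClass (G k)) := by
  constructor
  · have : Finite κ := Nat.finite_of_card_ne_zero (by rw [hG.card]; positivity)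
    have o : Fin (2 ^ m + 1) ≃ κ := (finCongr hG.card.symm).trans (Finite.equivFin κ).symm
    choose S hS using fun k => (hG.lagrangian k).exists_isEigenbasis
    exact ⟨fun k => S (o k), fun k => pauliClass (G (o k)),
      hG.pauliClass_injective.comp o.injective, o.surjective.range_comp fun k => pauliClass (G k), fun k => hS _⟩
  · rintro S ⟨𝒞, hinj, hrange, hS⟩ k l hkl
    obtain ⟨o, ho⟩ := hG.exists_equiv_of_range_eq hinj hrange
    exact IsEigenbasis.mutuallyUnbiased (hG.lagrangian _) (hG.lagrangian _)
      (hG.disjoint _ _ (o.injective.ne hkl)) (ho k ▸ hS k) (ho l ▸ hS l)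

/-- If a unitary matrix maps the eigenbases of each class of one spread to eigenbases of the
corresponding class of another, then the eigenbases of the two spreads are equivalent, since
eigenbases of a maximal commuting class agree up to monomial matrices. -/
lemma equivalentEigenbases (hG : IsSpread G) (hG' : IsSpread G')
    (U : Matrix.unitaryGroup (Qubits m) ℂ)
    (hU : ∀ k V, IsEigenbasis (pauliClass (G k)) V → IsEigenbasis (pauliClass (G' k)) (U * V)) :
    EquivalentEigenbases (Set.range fun k => pauliClass (G k))
      (Set.range fun k => pauliClass (G' k)) := by
  rintro S S' ⟨𝒞, hinj, hrange, hS⟩ ⟨𝒞', hinj', hrange', hS'⟩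
  obtain ⟨o, ho⟩ := hG.exists_equiv_of_range_eq hinj hrange
  obtain ⟨o', ho'⟩ := hG'.exists_equiv_of_range_eq hinj' hrange'
  have h : ∀ k, ∃ W : Matrix (Qubits m) (Qubits m) ℂ, IsMonomial W ∧
      (S' k : Matrix (Qubits m) (Qubits m) ℂ) =
        (U : Matrix (Qubits m) (Qubits m) ℂ) *
          (S (o'.trans o.symm k) : Matrix (Qubits m) (Qubits m) ℂ) * W := by
    intro k
    have h1 : IsEigenbasis (pauliClass (G (o' k))) (S (o'.trans o.symm k)) := by
      have h2 := hS (o'.trans o.symm k)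
      rwa [ho, Equiv.trans_apply, Equiv.apply_symm_apply] at h2
    exact (hU _ _ h1).exists_eq_mul_isMonomial (hG'.lagrangian _) (ho' k ▸ hS' k)
  choose W hW hSW using h
  exact ⟨U, o'.trans o.symm, W, hW, hSW⟩

end IsSpread

/-! ### The spread of a symmetric representation of the field with `2 ^ m` elements -/

/-- The class depends only on the column space of its generator. -/
lemma pauliClass_mul (G : Matrix (Fin m ⊕ Fin m) (Fin m) (ZMod 2))
    {N N' : Matrix (Fin m) (Fin m) (ZMod 2)} (hN : N * N' = 1) :
    pauliClass (G * N) = pauliClass G := by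
  have hN' : N' * N = 1 := mul_eq_one_comm.1 hN
  ext A
  constructor
  · rintro ⟨c, hc, rfl⟩
    refine ⟨N *ᵥ c, fun h => hc ?_, by rw [Matrix.mulVec_mulVec]⟩
    rw [← Matrix.one_mulVec c, ← hN', ← Matrix.mulVec_mulVec, h, Matrix.mulVec_zero]
  · rintro ⟨c, hc, rfl⟩
    refine ⟨N' *ᵥ c, fun h => hc ?_, ?_⟩
    · rw [← Matrix.one_mulVec c, ← hN, ← Matrix.mulVec_mulVec, h, Matrix.mulVec_zero]
    · rw [Matrix.mulVec_mulVec, Matrix.mul_assoc, hN, Matrix.mul_one]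

variable {K : Type*} [Field K] [Algebra (ZMod 2) K]

/-- The generators `(1, 0)ᵗ` and `(e x, 1)ᵗ`, `x ∈ K`, for a representation `e` of the field `K` by
matrices. -/
def fieldGenerator (e : K →ₐ[ZMod 2] Matrix (Fin m) (Fin m) (ZMod 2)) :
    Option K → Matrix (Fin m ⊕ Fin m) (Fin m) (ZMod 2)
  | none => zGenerator m
  | some x => Matrix.fromRows (e x) 1

lemma isLagrangian_zGenerator : IsLagrangian (zGenerator m) := by
  intro a
  have h : ∀ c, symp a (zGenerator m *ᵥ c) = xPart a ⬝ᵥ c := by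
    intro c
    simp [symp, zGenerator, Matrix.fromRows_mulVec]
  simp only [h]
  constructor
  · intro h0
    refine ⟨zPart a, ?_⟩
    have hx : xPart a = 0 := dotProduct_eq_zero_iff.1 h0
    rw [zGenerator, Matrix.fromRows_mulVec, Matrix.one_mulVec, Matrix.zero_mulVec, ← hx,
      Sum.elim_comp_inl_inr]
  · rintro ⟨c, rfl⟩ c'
    simp [zGenerator, Matrix.fromRows_mulVec]

lemma isLagrangian_fromRows_one {A : Matrix (Fin m) (Fin m) (ZMod 2)} (hA : A.IsSymm) :
    IsLagrangian (Matrix.fromRows A 1) := by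
  intro a
  have h : ∀ c, symp a (Matrix.fromRows A 1 *ᵥ c) = (zPart a + A *ᵥ xPart a) ⬝ᵥ c := by
    intro c
    have h1 : A *ᵥ xPart a ⬝ᵥ c = xPart a ⬝ᵥ A *ᵥ c := by
      rw [Matrix.dotProduct_mulVec, ← Matrix.mulVec_transpose, hA]
    simp [symp, Matrix.fromRows_mulVec, h1, add_dotProduct]
  simp only [h]
  constructor
  · intro h0
    refine ⟨xPart a, ?_⟩
    have hz : zPart a = A *ᵥ xPart a := by
      have h2 := dotProduct_eq_zero_iff.1 h0
      rw [eq_comm, qubits_eq_add_iff, zero_add] at h2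
      exact h2
    rw [Matrix.fromRows_mulVec, Matrix.one_mulVec, ← hz, Sum.elim_comp_inl_inr]
  · rintro ⟨c, rfl⟩ c'
    simp [Matrix.fromRows_mulVec, qubits_add_self]

lemma eq_zero_of_mulVec_eq_zero (e : K →ₐ[ZMod 2] Matrix (Fin m) (Fin m) (ZMod 2)) {x : K}
    (hx : x ≠ 0) {c : Fin m → ZMod 2} (h : e x *ᵥ c = 0) : c = 0 := by
  rw [← Matrix.one_mulVec c, ← map_one e, ← inv_mul_cancel₀ hx, map_mul, ← Matrix.mulVec_mulVec,
    h, Matrix.mulVec_zero]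

lemma isSpread_fieldGenerator (hm : 0 < m) (hK : Module.finrank (ZMod 2) K = m)
    (e : K →ₐ[ZMod 2] Matrix (Fin m) (Fin m) (ZMod 2)) (he : ∀ x, (e x).IsSymm) :
    IsSpread (fieldGenerator e) where
  pos := hm
  card := by
    have : Module.Finite (ZMod 2) K := Module.finite_of_finrank_pos (hK ▸ hm)
    have : Finite K := Module.finite_of_finite (ZMod 2)
    rw [Finite.card_option, Module.natCard_eq_pow_finrank (K := ZMod 2), hK, Nat.card_zmod]
  lagrangian k := by
    cases k with
    | none => exact isLagrangian_zGenerator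
    | some x => exact isLagrangian_fromRows_one (he x)
  injective k := by
    intro c c' h
    cases k with
    | none =>
      simpa [fieldGenerator, zGenerator, Matrix.fromRows_mulVec, Sum.elim_eq_iff] using h
    | some x =>
      simp only [fieldGenerator, Matrix.fromRows_mulVec, Sum.elim_eq_iff, Matrix.one_mulVec] at h
      exact h.2
  disjoint k l hkl c c' h := by
    cases k with
    | none =>
      cases l with
      | none => exact absurd rfl hkl
      | some y =>
        simp only [fieldGenerator, zGenerator, Matrix.fromRows_mulVec, Sum.elim_eq_iff,
          Matrix.one_mulVec, Matrix.zero_mulVec] at h ⊢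
        rw [h.1, ← h.2, Matrix.mulVec_zero, Sum.elim_zero_zero]
    | some x =>
      cases l with
      | none =>
        simp only [fieldGenerator, zGenerator, Matrix.fromRows_mulVec, Sum.elim_eq_iff,
          Matrix.one_mulVec, Matrix.zero_mulVec] at h ⊢
        rw [h.2, Matrix.mulVec_zero, Sum.elim_zero_zero]
      | some y =>
        simp only [fieldGenerator, Matrix.fromRows_mulVec, Sum.elim_eq_iff,
          Matrix.one_mulVec] at h ⊢
        obtain ⟨h, rfl⟩ := h
        have hxy : x - y ≠ 0 := sub_ne_zero.2 fun h => hkl (h ▸ rfl)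
        have hc : c = 0 := eq_zero_of_mulVec_eq_zero e hxy
          (by rw [map_sub, Matrix.sub_mulVec, h, sub_self])
        rw [hc, Matrix.mulVec_zero, Sum.elim_zero_zero]

/-! ### Symmetric representations of a field are orthogonally conjugate -/

/-- Every nonzero vector is cyclic: `𝔽₂ᵐ` is a one-dimensional `K`-space. -/
lemma exists_linearEquiv_mulVec (hm : 0 < m) (hK : Module.finrank (ZMod 2) K = m)
    (e : K →ₐ[ZMod 2] Matrix (Fin m) (Fin m) (ZMod 2)) :
    ∃ φ : K ≃ₗ[ZMod 2] (Fin m → ZMod 2), ∀ x y, φ (x * y) = e x *ᵥ φ y := by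
  have : Module.Finite (ZMod 2) K := Module.finite_of_finrank_pos (hK ▸ hm)
  have : Nonempty (Fin m) := ⟨⟨0, hm⟩⟩
  obtain ⟨v, hv⟩ := exists_ne (0 : Fin m → ZMod 2)
  let f : K →ₗ[ZMod 2] (Fin m → ZMod 2) :=
    (Matrix.mulVecBilin (ZMod 2) (ZMod 2)).flip v ∘ₗ e.toLinearMap
  have hf : ∀ x, f x = e x *ᵥ v := fun x => rfl
  have hinj : Function.Injective f := by
    rw [injective_iff_map_eq_zero]
    intro x hx
    by_contra h0
    exact hv (eq_zero_of_mulVec_eq_zero e h0 hx)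
  refine ⟨LinearEquiv.ofInjectiveOfFinrankEq f hinj (by simpa using hK), fun x y => ?_⟩
  change f (x * y) = e x *ᵥ f y
  rw [hf, hf, map_mul, Matrix.mulVec_mulVec]

/-- The image of `K` is its own centralizer, by the action on a cyclic vector. -/
lemma exists_eq_of_commute (hm : 0 < m) (hK : Module.finrank (ZMod 2) K = m)
    (e : K →ₐ[ZMod 2] Matrix (Fin m) (Fin m) (ZMod 2)) {M : Matrix (Fin m) (Fin m) (ZMod 2)}
    (hM : ∀ x, M * e x = e x * M) : ∃ r, M = e r := by
  obtain ⟨φ, hφ⟩ := exists_linearEquiv_mulVec hm hK e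
  refine ⟨φ.symm (M *ᵥ φ 1), Matrix.ext_of_mulVec_single fun i => ?_⟩
  obtain ⟨x, hx⟩ := φ.surjective (Pi.single i 1)
  rw [← hx, ← hφ, mul_comm, hφ, φ.apply_symm_apply, Matrix.mulVec_mulVec, ← hM,
    ← Matrix.mulVec_mulVec, ← hφ, mul_one]

/-- Two symmetric representations are conjugate by some `S`. As `Sᵀ * S` commutes with the first
one, it is the image of an element of `K`; this is a square, and dividing `S` by its square root
makes it orthogonal. -/
lemma exists_orthogonal_conj (hm : 0 < m) (hK : Module.finrank (ZMod 2) K = m)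
    (e e' : K →ₐ[ZMod 2] Matrix (Fin m) (Fin m) (ZMod 2)) (he : ∀ x, (e x).IsSymm)
    (he' : ∀ x, (e' x).IsSymm) :
    ∃ T : Matrix (Fin m) (Fin m) (ZMod 2), Tᵀ * T = 1 ∧ ∀ x, T * e x = e' x * T := by
  obtain ⟨φ, hφ⟩ := exists_linearEquiv_mulVec hm hK e
  obtain ⟨φ', hφ'⟩ := exists_linearEquiv_mulVec hm hK e'
  let ψ : (Fin m → ZMod 2) ≃ₗ[ZMod 2] (Fin m → ZMod 2) := φ.symm.trans φ'
  set S : Matrix (Fin m) (Fin m) (ZMod 2) := LinearMap.toMatrix' ψ.toLinearMap with hS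
  have hSφ : ∀ y, S *ᵥ φ y = φ' y := by
    intro y
    rw [hS, LinearMap.toMatrix'_mulVec]
    simp [ψ]
  have hSe : ∀ x, S * e x = e' x * S := by
    intro x
    refine Matrix.ext_of_mulVec_single fun i => ?_
    obtain ⟨y, hy⟩ := φ.surjective (Pi.single i 1)
    rw [← hy, ← Matrix.mulVec_mulVec, ← hφ, hSφ, hφ', ← hSφ, Matrix.mulVec_mulVec]
  obtain ⟨r, hr⟩ := exists_eq_of_commute hm hK e (M := Sᵀ * S) (by
    intro x
    have h := congrArg Matrix.transpose (hSe x)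
    rw [Matrix.transpose_mul, Matrix.transpose_mul, he x, he' x] at h
    rw [Matrix.mul_assoc, hSe, ← Matrix.mul_assoc, ← h, Matrix.mul_assoc])
  have hSunit : IsUnit S := by
    rw [hS]
    exact LinearMap.isUnit_toMatrix'_iff.2 ((Module.End.isUnit_iff _).2 ψ.bijective)
  have : Nonempty (Fin m) := ⟨⟨0, hm⟩⟩
  have hr0 : r ≠ 0 := by
    rintro rfl
    rw [map_zero] at hr
    exact not_isUnit_zero (hr ▸ (hSunit.map (Matrix.transposeRingEquiv _ _)).unop.mul hSunit)
  have : Module.Finite (ZMod 2) K := Module.finite_of_finrank_pos (hK ▸ hm)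
  have : Finite K := Module.finite_of_finite (ZMod 2)
  have : CharP K 2 := charP_of_injective_algebraMap (algebraMap (ZMod 2) K).injective 2
  obtain ⟨s, rfl⟩ := FiniteField.isSquare_of_char_two (ringChar.eq K 2) r
  have hs : s ≠ 0 := left_ne_zero_of_mul hr0
  refine ⟨S * e s⁻¹, ?_, fun x => ?_⟩
  · rw [Matrix.transpose_mul, he, Matrix.mul_assoc, ← Matrix.mul_assoc Sᵀ, hr, ← map_mul,
      ← map_mul, mul_inv_cancel_right₀ hs, inv_mul_cancel₀ hs, map_one]
  · rw [Matrix.mul_assoc, ← map_mul, mul_comm, map_mul, ← Matrix.mul_assoc, hSe, Matrix.mul_assoc]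

/-! ### The unitary operator of an orthogonal matrix over `𝔽₂` -/

/-- The permutation matrix `|j⟩ ↦ |T j⟩` for an orthogonal matrix `T` over `𝔽₂`. -/
def basisPerm (T : Matrix (Fin m) (Fin m) (ZMod 2)) : Matrix (Qubits m) (Qubits m) ℂ :=
  Matrix.of fun i j => if i = T *ᵥ j then 1 else 0

lemma mulVec_injective_of_orthogonal {T : Matrix (Fin m) (Fin m) (ZMod 2)} (hT : Tᵀ * T = 1) :
    Function.Injective (T *ᵥ ·) := by
  intro i j h
  have h' := congrArg (Tᵀ *ᵥ ·) h
  simpa [Matrix.mulVec_mulVec, hT] using h'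

lemma basisPerm_mem_unitaryGroup {T : Matrix (Fin m) (Fin m) (ZMod 2)} (hT : Tᵀ * T = 1) :
    basisPerm T ∈ Matrix.unitaryGroup (Qubits m) ℂ := by
  rw [Matrix.mem_unitaryGroup_iff']
  ext i j
  simp [basisPerm, Matrix.mul_apply, Matrix.star_apply, Matrix.one_apply,
    (mulVec_injective_of_orthogonal hT).eq_iff, apply_ite, eq_comm]

lemma dotProduct_mulVec_of_orthogonal {T : Matrix (Fin m) (Fin m) (ZMod 2)} (hT : Tᵀ * T = 1)
    (z j : Fin m → ZMod 2) : T *ᵥ z ⬝ᵥ T *ᵥ j = z ⬝ᵥ j := by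
  rw [Matrix.dotProduct_mulVec, Matrix.vecMul_mulVec, hT, Matrix.vecMul_one]

/-- Conjugation by the operator `|j⟩ ↦ |T j⟩` maps the Pauli operator of `(z | x)` to a scalar
multiple of that of `(T z | T x)`. -/
lemma pauli_mul_basisPerm {T : Matrix (Fin m) (Fin m) (ZMod 2)} (hT : Tᵀ * T = 1)
    (a : Fin m ⊕ Fin m → ZMod 2) :
    pauli (Matrix.fromBlocks T 0 0 T *ᵥ a) * basisPerm T =
      (phase (Matrix.fromBlocks T 0 0 T *ᵥ a) / phase a) • (basisPerm T * pauli a) := by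
  ext i j
  have hz : zPart (Matrix.fromBlocks T 0 0 T *ᵥ a) = T *ᵥ zPart a := by
    simp [Matrix.fromBlocks_mulVec]
  have hx : xPart (Matrix.fromBlocks T 0 0 T *ᵥ a) = T *ᵥ xPart a := by
    simp [Matrix.fromBlocks_mulVec]
  simp only [Matrix.mul_apply, basisPerm, Matrix.of_apply, Matrix.smul_apply, mul_ite, mul_one,
    mul_zero, Finset.sum_ite_eq', Finset.mem_univ, if_true, pauli_apply, hz, hx,
    dotProduct_mulVec_of_orthogonal hT, Matrix.mulVec_add, smul_eq_mul]
  split_ifs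
  · field_simp [phase_ne_zero a]
  · rw [zero_mul, mul_zero]

lemma IsEigenbasis.basisPerm_mul {T : Matrix (Fin m) (Fin m) (ZMod 2)} (hT : Tᵀ * T = 1)
    {G : Matrix (Fin m ⊕ Fin m) (Fin m) (ZMod 2)} {V : Matrix.unitaryGroup (Qubits m) ℂ}
    (hV : IsEigenbasis (pauliClass G) V) :
    IsEigenbasis (pauliClass (Matrix.fromBlocks T 0 0 T * G))
      ((⟨basisPerm T, basisPerm_mem_unitaryGroup hT⟩ : Matrix.unitaryGroup (Qubits m) ℂ) * V) := by
  rintro _ ⟨c, hc, rfl⟩ j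
  obtain ⟨μ, hμ⟩ := hV _ ⟨c, hc, rfl⟩ j
  refine ⟨phase (Matrix.fromBlocks T 0 0 T *ᵥ (G *ᵥ c)) / phase (G *ᵥ c) * μ, ?_⟩
  change pauli _ *ᵥ (basisPerm T *ᵥ fun i => (V : Matrix (Qubits m) (Qubits m) ℂ) i j) =
    _ • (basisPerm T *ᵥ fun i => (V : Matrix (Qubits m) (Qubits m) ℂ) i j)
  rw [Matrix.mulVec_mulVec, ← Matrix.mulVec_mulVec c, pauli_mul_basisPerm hT, Matrix.smul_mulVec,
    ← Matrix.mulVec_mulVec, hμ, Matrix.mulVec_smul, smul_smul]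

lemma equivalentEigenbases_fieldGenerator (hm : 0 < m) (hK : Module.finrank (ZMod 2) K = m)
    (e e' : K →ₐ[ZMod 2] Matrix (Fin m) (Fin m) (ZMod 2)) (he : ∀ x, (e x).IsSymm)
    (he' : ∀ x, (e' x).IsSymm) :
    EquivalentEigenbases (Set.range fun k => pauliClass (fieldGenerator e k))
      (Set.range fun k => pauliClass (fieldGenerator e' k)) := by
  obtain ⟨T, hT, hTe⟩ := exists_orthogonal_conj hm hK e e' he he'
  refine (isSpread_fieldGenerator hm hK e he).equivalentEigenbases
    (isSpread_fieldGenerator hm hK e' he') ⟨basisPerm T, basisPerm_mem_unitaryGroup hT⟩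
    fun k V hV => ?_
  have h : Matrix.fromBlocks T 0 0 T * fieldGenerator e k = fieldGenerator e' k * T := by
    cases k with
    | none => simp [fieldGenerator, zGenerator, Matrix.fromBlocks_mul_fromRows, Matrix.fromRows_mul]
    | some x =>
      simp [fieldGenerator, Matrix.fromBlocks_mul_fromRows, Matrix.fromRows_mul, hTe]
  have hV' := hV.basisPerm_mul hT
  rwa [h, pauliClass_mul _ (mul_eq_one_comm.1 hT)] at hV'

/-! ### The field generated by `B` -/

/-- The representation `q ↦ q(B)` of `𝔽₂[X] / p`, where `p` is the characteristic polynomial of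
`B`. -/
def evalAt {p : (ZMod 2)[X]} (B : Matrix (Fin m) (Fin m) (ZMod 2)) (hB : B.charpoly = p) :
    AdjoinRoot p →ₐ[ZMod 2] Matrix (Fin m) (Fin m) (ZMod 2) :=
  Ideal.Quotient.liftₐ (Ideal.span {p}) (aeval B) (by
    intro q hq
    obtain ⟨r, rfl⟩ := Ideal.mem_span_singleton.1 hq
    rw [map_mul, ← hB, Matrix.aeval_self_charpoly, zero_mul])

lemma evalAt_mk {p : (ZMod 2)[X]} {B : Matrix (Fin m) (Fin m) (ZMod 2)} (hB : B.charpoly = p)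
    (q : (ZMod 2)[X]) : evalAt B hB (AdjoinRoot.mk p q) = aeval B q := rfl

lemma isSymm_evalAt {p : (ZMod 2)[X]} {B : Matrix (Fin m) (Fin m) (ZMod 2)}
    (hB : B.charpoly = p) (hsymm : B.IsSymm) (x : AdjoinRoot p) : (evalAt B hB x).IsSymm := by
  induction x using AdjoinRoot.induction_on with
  | ih q =>
    rw [evalAt_mk, Matrix.IsSymm]
    induction q using Polynomial.induction_on' with
    | add q r hq hr => rw [map_add, Matrix.transpose_add, hq, hr]
    | monomial n a =>
      rw [Polynomial.aeval_monomial, ← Algebra.smul_def, Matrix.transpose_smul,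
        Matrix.transpose_pow, hsymm]

lemma finrank_adjoinRoot_charpoly {p : (ZMod 2)[X]} (hp : Irreducible p)
    {B : Matrix (Fin m) (Fin m) (ZMod 2)} (hB : B.charpoly = p) :
    Module.finrank (ZMod 2) (AdjoinRoot p) = m := by
  rw [(AdjoinRoot.powerBasis hp.ne_zero).finrank, AdjoinRoot.powerBasis_dim, ← hB,
    Matrix.charpoly_natDegree_eq_dim, Fintype.card_fin]

lemma pos_of_irreducible_charpoly {B : Matrix (Fin m) (Fin m) (ZMod 2)}
    (hB : Irreducible B.charpoly) : 0 < m := by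
  have h := hB.natDegree_pos
  rwa [Matrix.charpoly_natDegree_eq_dim, Fintype.card_fin] at h

lemma standardClasses_eq_range {p : (ZMod 2)[X]} [Fact (Irreducible p)]
    {B : Matrix (Fin m) (Fin m) (ZMod 2)} (hB : B.charpoly = p) :
    standardClasses B = Set.range fun k => pauliClass (fieldGenerator (evalAt B hB) k) := by
  ext 𝒞
  constructor
  · rintro (rfl | ⟨q, -, rfl⟩)
    · exact ⟨none, rfl⟩
    · exact ⟨some (AdjoinRoot.mk p q), rfl⟩
  · rintro ⟨_ | x, rfl⟩
    · exact Or.inl rfl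
    · obtain ⟨q, rfl⟩ := AdjoinRoot.mk_surjective x
      have hmonic : p.Monic := hB ▸ B.charpoly_monic
      refine Or.inr ⟨q %ₘ p, ?_, ?_⟩
      · refine (Polynomial.degree_modByMonic_lt q hmonic).trans_eq ?_
        rw [← hB, Matrix.charpoly_degree_eq_dim, Fintype.card_fin]
      · have h : AdjoinRoot.mk p (q %ₘ p) = AdjoinRoot.mk p q := by
          rw [AdjoinRoot.mk_eq_mk, Polynomial.modByMonic_eq_sub_mul_div]
          exact ⟨-(q /ₘ p), by ring⟩
        rw [← evalAt_mk hB, h]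
        rfl

/-! ### Cyclic classes and Fibonacci polynomials -/

lemma stabilizer_pow_mul_zGenerator (B : Matrix (Fin m) (Fin m) (ZMod 2)) (k : ℕ) :
    stabilizer B ^ k * zGenerator m =
      Matrix.fromRows (aeval B (fibPoly (k + 1))) (aeval B (fibPoly k)) := by
  induction k with
  | zero => simp [fibPoly, zGenerator]
  | succ k ih =>
    rw [pow_succ', Matrix.mul_assoc, ih, stabilizer, Matrix.fromBlocks_mul_fromRows]
    simp [fibPoly]

/-- D'Ocagne's identity in characteristic two. -/
lemma fibPoly_docagne (k n : ℕ) :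
    fibPoly (k + 1) * fibPoly (k + n) - fibPoly (k + n + 1) * fibPoly k = fibPoly n := by
  induction k with
  | zero => simp [fibPoly]
  | succ k ih =>
    have h1 : fibPoly (k + 1 + 1) = X * fibPoly (k + 1) + fibPoly k := rfl
    have h2 : fibPoly (k + n + 1 + 1) = X * fibPoly (k + n + 1) + fibPoly (k + n) := rfl
    rw [show k + 1 + n = k + n + 1 by ring, h1, h2, ← ih]
    have h3 : (2 : (ZMod 2)[X]) = 0 := CharTwo.two_eq_zero
    linear_combination (fibPoly k * fibPoly (k + n + 1) - fibPoly (k + 1) * fibPoly (k + n)) * h3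

/-- The index in the spread of the `k`-th cyclic class: the ratio of consecutive Fibonacci
polynomials modulo `p`, or `none` if the denominator vanishes at `k = 0`. -/
def fibRatio (p : (ZMod 2)[X]) [Fact (Irreducible p)] (k : ℕ) : Option (AdjoinRoot p) :=
  if k = 0 then none else
    some (AdjoinRoot.mk p (fibPoly (k + 1)) * (AdjoinRoot.mk p (fibPoly k))⁻¹)

lemma HasFibIndex.mk_fibPoly_ne_zero {p : (ZMod 2)[X]} {N : ℕ} (h : HasFibIndex p N) {k : ℕ}
    (hk : 0 < k) (hkN : k < N) : AdjoinRoot.mk p (fibPoly k) ≠ 0 := fun h0 =>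
  (h.2 ⟨hk, AdjoinRoot.mk_eq_zero.1 h0⟩).not_gt hkN

/-- If `F_{k+1} / F_k = F_{k+n+1} / F_{k+n}` modulo `p`, then `p` divides `F_n`. -/
lemma HasFibIndex.fibRatio_injOn {p : (ZMod 2)[X]} [Fact (Irreducible p)] {N : ℕ}
    (h : HasFibIndex p N) : Set.InjOn (fibRatio p) (Set.Iio N) := by
  have key : ∀ k n : ℕ, 0 < n → k + n < N → fibRatio p k ≠ fibRatio p (k + n) := by
    intro k n hn hkn heq
    rcases Nat.eq_zero_or_pos k with rfl | hk
    · simp [fibRatio, hn.ne'] at heq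
    · have hk0 := h.mk_fibPoly_ne_zero hk (by omega)
      have hkn0 := h.mk_fibPoly_ne_zero (k := k + n) (by omega) hkn
      rw [fibRatio, fibRatio, if_neg hk.ne', if_neg (by omega), Option.some_inj,
        ← div_eq_mul_inv, ← div_eq_mul_inv, div_eq_div_iff hk0 hkn0] at heq
      refine h.mk_fibPoly_ne_zero hn (by omega) ?_
      rw [← fibPoly_docagne k n, map_sub, map_mul, map_mul, heq, sub_self]
  intro k hk l hl heq
  rcases lt_trichotomy k l with hlt | rfl | hlt
  · obtain ⟨n, rfl⟩ := Nat.exists_eq_add_of_lt hlt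
    exact absurd heq (key k (n + 1) n.succ_pos hl)
  · rfl
  · obtain ⟨n, rfl⟩ := Nat.exists_eq_add_of_lt hlt
    exact absurd heq.symm (key l (n + 1) n.succ_pos hk)

lemma pauliClass_stabilizer_pow {p : (ZMod 2)[X]} [Fact (Irreducible p)]
    {B : Matrix (Fin m) (Fin m) (ZMod 2)} (hB : B.charpoly = p) {N : ℕ} (h : HasFibIndex p N)
    {k : ℕ} (hk : k < N) : pauliClass (stabilizer B ^ k * zGenerator m) =
      pauliClass (fieldGenerator (evalAt B hB) (fibRatio p k)) := by
  rcases Nat.eq_zero_or_pos k with rfl | hk0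
  · simp [fibRatio, fieldGenerator]
  · have hne := h.mk_fibPoly_ne_zero hk0 hk
    have hinv : evalAt B hB (AdjoinRoot.mk p (fibPoly k)) *
        evalAt B hB (AdjoinRoot.mk p (fibPoly k))⁻¹ = 1 := by
      rw [← map_mul, mul_inv_cancel₀ hne, map_one]
    rw [fibRatio, if_neg hk0.ne', fieldGenerator, ← pauliClass_mul (Matrix.fromRows _ _) hinv, Matrix.fromRows_mul,
      ← map_mul, inv_mul_cancel_right₀ hne, Matrix.one_mul, stabilizer_pow_mul_zGenerator,
      evalAt_mk, evalAt_mk]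

/-- If the Fibonacci index is `2 ^ m + 1`, the cyclic classes are the standard classes: they are
`2 ^ m + 1` distinct ones among these. -/
lemma cyclicClasses_eq_standardClasses {B : Matrix (Fin m) (Fin m) (ZMod 2)}
    (hirr : Irreducible B.charpoly) (hB : B.IsSymm) (h : HasFibIndex B.charpoly (2 ^ m + 1)) :
    cyclicClasses B = standardClasses B := by
  have : Fact (Irreducible B.charpoly) := ⟨hirr⟩
  have hspread := isSpread_fieldGenerator (pos_of_irreducible_charpoly hirr)
    (finrank_adjoinRoot_charpoly hirr rfl) (evalAt B rfl) (isSymm_evalAt rfl hB)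
  have : Finite (Option (AdjoinRoot B.charpoly)) :=
    Nat.finite_of_card_ne_zero (by rw [hspread.card]; positivity)
  have hbij : Function.Bijective fun k : Fin (2 ^ m + 1) => fibRatio B.charpoly k := by
    refine (Nat.bijective_iff_injective_and_card _).2 ⟨fun k l hkl => ?_, ?_⟩
    · exact Fin.ext (h.fibRatio_injOn k.2 l.2 hkl)
    · rw [hspread.card, Nat.card_fin]
  rw [standardClasses_eq_range rfl]
  ext 𝒞
  constructor
  · rintro ⟨k, hk, rfl⟩
    exact ⟨fibRatio B.charpoly k, (pauliClass_stabilizer_pow rfl h (by omega)).symm⟩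
  · rintro ⟨o, rfl⟩
    obtain ⟨k, rfl⟩ := hbij.2 o
    exact ⟨k, by omega, (pauliClass_stabilizer_pow rfl h k.2).symm⟩

lemma generatesCompleteMUB_standardClasses {B : Matrix (Fin m) (Fin m) (ZMod 2)}
    (hirr : Irreducible B.charpoly) (hB : B.IsSymm) :
    GeneratesCompleteMUB (standardClasses B) := by
  have : Fact (Irreducible B.charpoly) := ⟨hirr⟩
  rw [standardClasses_eq_range rfl]
  exact (isSpread_fieldGenerator (pos_of_irreducible_charpoly hirr)
    (finrank_adjoinRoot_charpoly hirr rfl) _ (isSymm_evalAt rfl hB)).generatesCompleteMUB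

lemma equivalentEigenbases_standardClasses {B B' : Matrix (Fin m) (Fin m) (ZMod 2)}
    (hirr : Irreducible B.charpoly) (hB : B.IsSymm) (hB' : B'.IsSymm)
    (hchar : B'.charpoly = B.charpoly) :
    EquivalentEigenbases (standardClasses B) (standardClasses B') := by
  have : Fact (Irreducible B.charpoly) := ⟨hirr⟩
  rw [standardClasses_eq_range rfl, standardClasses_eq_range hchar]
  exact equivalentEigenbases_fieldGenerator (pos_of_irreducible_charpoly hirr)
    (finrank_adjoinRoot_charpoly hirr rfl) _ _ (isSymm_evalAt rfl hB) (isSymm_evalAt hchar hB')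

end

end CyclicMUB

theorem mainTheorem5 (m : ℕ) (B B' : Matrix (Fin m) (Fin m) (ZMod 2))
    (hB : B.IsSymm) (hB' : B'.IsSymm)
    (hirr : Irreducible B.charpoly) (hchar : B'.charpoly = B.charpoly) :
    (CyclicMUB.GeneratesCompleteMUB (CyclicMUB.standardClasses B) ∧
      CyclicMUB.GeneratesCompleteMUB (CyclicMUB.standardClasses B') ∧
      CyclicMUB.EquivalentEigenbases
        (CyclicMUB.standardClasses B) (CyclicMUB.standardClasses B')) ∧
    (CyclicMUB.HasFibIndex B.charpoly (2 ^ m + 1) →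
      CyclicMUB.GeneratesCompleteMUB (CyclicMUB.cyclicClasses B) ∧
      CyclicMUB.GeneratesCompleteMUB (CyclicMUB.cyclicClasses B') ∧
      CyclicMUB.EquivalentEigenbases
        (CyclicMUB.cyclicClasses B) (CyclicMUB.cyclicClasses B')) := by
  have hirr' : Irreducible B'.charpoly := hchar.symm ▸ hirr
  have hstandard := And.intro (CyclicMUB.generatesCompleteMUB_standardClasses hirr hB)
    (And.intro (CyclicMUB.generatesCompleteMUB_standardClasses hirr' hB')
      (CyclicMUB.equivalentEigenbases_standardClasses hirr hB hB' hchar))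
  refine ⟨hstandard, fun h => ?_⟩
  rw [CyclicMUB.cyclicClasses_eq_standardClasses hirr hB h,
    CyclicMUB.cyclicClasses_eq_standardClasses hirr' hB' (hchar.symm ▸ h)]
  exact hstandard
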